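/- **Theorem.** Let $X$ be a (real) Banach lattice. The following statements are equivalent. 1. For every net $(x_\alpha)$ in $X$: $x_\alpha\xrightarrow{uo}0$ if and only if $x_\alpha\xrightarrow{un}0$. 2. For every sequence $(x_n)$ in $X$: $x_n\xrightarrow{uo}0$ if and only if $x_n\xrightarrow{un}0$. 3. $X$ is order continuous and atomic. Here nets are indexed by non-empty directed preordered sets, and $y_\beta\downarrow 0$ means that the net $(y_\beta)$ is decreasing with infimum $0$. * A net $(x_\alpha)_{\alpha\in A}$ *order converges* to $x$, written $x_\alpha\xrightarrow{o}x$, if there is a net $(y_\beta)_{\beta\in B}$ in $X$, possibly over a different index set, such that $y_\beta\downarrow 0$ and for each $\beta\in B$ there is $\alpha_\beta\in A$ with $|x_\alpha-x|\le y_\beta$ for all $\alpha\ge\alpha_\beta$. * $x_\alpha\xrightarrow{uo}x$ means that $|x_\alpha-x|\wedge u\xrightarrow{o}0$ for every $u\in X_+$. * $x_\alpha\xrightarrow{un}x$ means that $\big\||x_\alpha-x|\wedge u\big\|\to 0$ for every $u\in X_+$. * $X$ is *order continuous* if $x_\alpha\downarrow 0$ implies $\|x_\alpha\|\downarrow 0$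 for every net $(x_\alpha)$ in $X$. * An *atom* is an element $a>0$ such that every $x\in[0,a]$ is of the form $x=\lambda a$ with a real $\lambda\ge 0$. $X$ is *atomic* if the band generated by its atoms is $X$, where a *band* is a solid linear subspace that contains the supremum of each of its subsets having a supremum in $X$. -/

import Mathlib

open Filter Topology

universe u v

/-- `y` decreases to `0` (written `y ↓ 0`): it is decreasing and its infimum is `0`. -/
def DecreasesToZero {B E : Type*} [Preorder B] [PartialOrder E] [Zero E] (y : B → E) : Prop :=
  Antitone y ∧ IsGLB (Set.range y) 0

section VectorLattice

variable {X : Type u} [AddCommGroup X] [Lattice X]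

/-- Order convergence of a net `x : A → X` to `l`: the net `|x α - l|` is eventually dominated by
every term of some net `y ↓ 0`, whose directed index set `B` may differ from `A`.
Letting `B` range over types in the universe of `X` is no restriction, as a net `y ↓ 0` can be
reindexed by its range, which is a subset of `X`, directed by the reversed order. -/
def OrderConvergesTo {A : Type v} [Preorder A] (x : A → X) (l : X) : Prop :=
  ∃ (B : Type u) (_ : Preorder B) (_ : IsDirectedOrder B) (_ : Nonempty B) (y : B → X),
    DecreasesToZero y ∧ ∀ β : B, ∃ α₀ : A, ∀ α : A, α₀ ≤ α → |x α - l| ≤ y β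

/-- Unbounded order convergence (uo-convergence) of a net. -/
def UOConvergesTo {A : Type v} [Preorder A] (x : A → X) (l : X) : Prop :=
  ∀ u : X, 0 ≤ u → OrderConvergesTo (fun α => |x α - l| ⊓ u) 0

/-- An atom of a vector lattice: `a > 0` such that each element of `[0, a]` is a nonnegative
multiple of `a`. (This is not the order-theoretic `IsAtom`.) -/
def IsVectorLatticeAtom [Module ℝ X] (a : X) : Prop :=
  0 < a ∧ ∀ x : X, 0 ≤ x → x ≤ a → ∃ c : ℝ, 0 ≤ c ∧ x = c • a

/-- A band: a solid linear subspace (an ideal) that contains the supremum of each of its subsets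
that has a supremum in `X`. -/
def IsBand [Module ℝ X] (M : Submodule ℝ X) : Prop :=
  LatticeOrderedAddCommGroup.IsSolid (M : Set X) ∧
    ∀ (D : Set X) (s : X), D ⊆ M → IsLUB D s → s ∈ M

/-- The band generated by a set: the intersection of all bands that contain it. -/
def bandGenerated [Module ℝ X] (S : Set X) : Submodule ℝ X :=
  sInf {M : Submodule ℝ X | IsBand M ∧ S ⊆ M}

variable (X) in
/-- A vector lattice is atomic if the band generated by its atoms is the whole space. -/
def IsAtomicVectorLattice [Module ℝ X] : Prop :=
  bandGenerated {a : X | IsVectorLatticeAtom a} = ⊤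

end VectorLattice

section NormedLattice

variable {X : Type u} [NormedAddCommGroup X] [Lattice X]

/-- Unbounded norm convergence (un-convergence) of a net. -/
def UNConvergesTo {A : Type v} [Preorder A] (x : A → X) (l : X) : Prop :=
  ∀ u : X, 0 ≤ u → Tendsto (fun α => ‖|x α - l| ⊓ u‖) atTop (𝓝 0)

variable (X) in
/-- A normed lattice is order continuous if `x ↓ 0` implies `‖x‖ ↓ 0` for every net `x`.
Index sets in the universe of `X` suffice, as such a net can be reindexed by its range. -/
def IsOrderContinuousLattice : Prop :=
  ∀ (A : Type u) [Preorder A] [IsDirectedOrder A] [Nonempty A] (x : A → X),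
    DecreasesToZero x → DecreasesToZero (fun α => ‖x α‖)

end NormedLattice

/-!
The Archimedean property replaces order completeness throughout. A net is order null as soon as the
eventual upper bounds of its absolute values have infimum `0`
(`orderConvergesTo_zero_of_forall_le`).

Suppose that uo-null and un-null sequences agree. If `y` is a decreasing sequence bounded below,
then `y n - y (n + 1)` is order null (`orderConvergesTo_sub_succ`), hence norm null. Consequently
every order bounded decreasing net is norm Cauchy, and its limit is its infimum, so `X` is order
continuous. For the same reason every order bounded disjoint sequence is norm null.

Suppose further that some `e > 0` had no atom below it, and for `ε > 0` consider the finite suprema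
of elements of `[0, e]` of norm at most `ε`. They converge in norm to some `e - v` with `v ≥ 0`. If
`v` were positive, it could be split again and again to give a disjoint sequence of elements
`p n ≤ v`, and by the choice of `v` suitable multiples of the `p n` would stay below `e` while their
norms approach `ε`, which is impossible. Thus `v = 0`
(`DecrementsTendToZero.exists_finset_sup'_near`). Listing such finite sets for `ε = 1 / (k + 1)` one
after the other gives a norm null, hence un-null, sequence whose tails have only upper bounds above
`e` (`DecrementsTendToZero.exists_typewriter_seq`), so it is not uo-null. Therefore every positive
element dominates an atom, which means that `X` is atomic.

Conversely, order continuity turns domination by a net decreasing to `0` into norm convergence, so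
uo-null nets are un-null. If `X` is atomic, a positive lower bound of all eventual upper bounds of
`|x α| ⊓ u` would have a positive coordinate at some atom `a`; but un-convergence makes the
coordinates of `x α` at `a` tend to `0`, so that the coordinate of `u` at `a` can be replaced by an
arbitrarily small one to give another eventual upper bound
(`IsAtomicVectorLattice.uoConvergesTo_zero`).
-/

/-! ### Disjointness and order convergence in vector lattices -/

section VectorLattice

lemma inf_eq_zero_of_le {X : Type u} [AddCommGroup X] [Lattice X] {a b a' b' : X}
    (ha : 0 ≤ a) (hb : 0 ≤ b) (haa : a ≤ a') (hbb : b ≤ b')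
    (h : a' ⊓ b' = 0) : a ⊓ b = 0 :=
  le_antisymm ((inf_le_inf haa hbb).trans h.le) (le_inf ha hb)

lemma abs_smul_le {X : Type u} [AddCommGroup X] [Lattice X] [Module ℝ X] [IsOrderedModule ℝ X]
    (c : ℝ) (x : X) : |c • x| ≤ |c| • |x| := by
  have key : ∀ z : X, |z| = |x| → c • z ≤ |c| • |x| := by
    intro z hz
    rcases le_total 0 c with hc | hc
    · rw [abs_of_nonneg hc]
      exact smul_le_smul_of_nonneg_left (hz ▸ le_abs_self z) hc
    · rw [abs_of_nonpos hc, ← neg_smul_neg]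
      exact smul_le_smul_of_nonneg_left (hz ▸ neg_le_abs z) (neg_nonneg.2 hc)
  exact abs_le'.2 ⟨key x rfl, by simpa using key (-x) (abs_neg x)⟩

variable {X : Type u} [AddCommGroup X] [Lattice X] [IsOrderedAddMonoid X]

lemma inf_add_le_inf_add_inf {a x y : X} (ha : 0 ≤ a) (hx : 0 ≤ x) (hy : 0 ≤ y) :
    a ⊓ (x + y) ≤ a ⊓ x + a ⊓ y := by
  have h1 : a ⊓ (x + y) - y ≤ a ⊓ x := le_inf
    ((sub_le_self _ hy).trans inf_le_left) (sub_le_iff_le_add.2 inf_le_right)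
  have h2 : a ⊓ (x + y) - a ⊓ x ≤ a ⊓ y := le_inf
    ((sub_le_self _ (le_inf ha hx)).trans inf_le_left) (by rwa [sub_le_comm])
  exact sub_le_iff_le_add'.1 h2

lemma inf_add_eq_zero {a x y : X} (ha : 0 ≤ a) (hx : 0 ≤ x) (hy : 0 ≤ y)
    (h1 : a ⊓ x = 0) (h2 : a ⊓ y = 0) : a ⊓ (x + y) = 0 :=
  le_antisymm ((inf_add_le_inf_add_inf ha hx hy).trans (by simp [h1, h2]))
    (le_inf ha (add_nonneg hx hy))

lemma inf_nsmul_eq_zero {a b : X} (ha : 0 ≤ a) (hb : 0 ≤ b) (h : a ⊓ b = 0) (n : ℕ) :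
    a ⊓ n • b = 0 := by
  induction n with
  | zero => simpa using ha
  | succ n ih => rw [succ_nsmul]; exact inf_add_eq_zero ha (nsmul_nonneg hb n) hb ih h

lemma inf_sum_eq_zero {ι : Type*} {a : X} (ha : 0 ≤ a) (s : Finset ι) (f : ι → X)
    (hf : ∀ i ∈ s, 0 ≤ f i) (h : ∀ i ∈ s, a ⊓ f i = 0) : a ⊓ ∑ i ∈ s, f i = 0 := by
  classical
  induction s using Finset.induction_on with
  | empty => simpa using ha
  | insert i s hi ih =>
    simp only [Finset.mem_insert, forall_eq_or_imp] at hf h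
    rw [Finset.sum_insert hi]
    exact inf_add_eq_zero ha hf.1 (Finset.sum_nonneg hf.2) h.1 (ih hf.2 h.2)

lemma inf_smul_eq_zero [Module ℝ X] [IsOrderedModule ℝ X] {a b : X} (ha : 0 ≤ a)
    (hb : 0 ≤ b) (h : a ⊓ b = 0) {t : ℝ} (ht : 0 ≤ t) :
    a ⊓ t • b = 0 := by
  obtain ⟨n, hn⟩ := exists_nat_ge t
  refine inf_eq_zero_of_le ha (smul_nonneg ht hb) le_rfl ?_ (inf_nsmul_eq_zero ha hb h n)
  rw [← Nat.cast_smul_eq_nsmul ℝ]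
  exact smul_le_smul_of_nonneg_right hn hb

lemma add_le_of_inf_eq_zero {a b c : X} (h : a ⊓ b = 0) (ha : a ≤ c) (hb : b ≤ c) :
    a + b ≤ c := by
  rw [← inf_add_sup, h, zero_add]
  exact sup_le ha hb

lemma sum_range_le_of_disjoint {p : ℕ → X} {u : X} (hu : 0 ≤ u) (hp : ∀ n, 0 ≤ p n)
    (hpu : ∀ n, p n ≤ u) (hd : ∀ i j, i < j → p i ⊓ p j = 0) (n : ℕ) :
    ∑ i ∈ Finset.range n, p i ≤ u := by
  induction n with
  | zero => simpa using hu
  | succ n ih =>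
    rw [Finset.sum_range_succ]
    refine add_le_of_inf_eq_zero ?_ ih (hpu n)
    rw [inf_comm]
    refine inf_sum_eq_zero (hp n) _ _ (fun i _ => hp i) fun i hi => ?_
    rw [inf_comm]
    exact hd i n (Finset.mem_range.1 hi)

/-- Criterion for order convergence that avoids order completeness: the eventual upper bounds of
`|x α|` form a downward directed set, which serves as the dominating net as soon as its infimum
is `0`. -/
lemma orderConvergesTo_zero_of_forall_le {A : Type v} [Preorder A] [IsDirectedOrder A] [Nonempty A]
    {x : A → X} {u : X} (hu : ∀ α, |x α| ≤ u)
    (h : ∀ w : X, 0 ≤ w → (∀ y α₀, (∀ α, α₀ ≤ α → |x α| ≤ y) → w ≤ y) → w = 0) :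
    OrderConvergesTo x 0 := by
  let S : Set X := {y | ∃ α₀, ∀ α, α₀ ≤ α → |x α| ≤ y}
  have hS : ∀ y ∈ S, 0 ≤ y := fun y ⟨α₀, hy⟩ => (abs_nonneg _).trans (hy α₀ le_rfl)
  have hdir : IsDirectedOrder (↥S)ᵒᵈ := by
    refine ⟨fun y z => ?_⟩
    obtain ⟨y, α, hy⟩ := y
    obtain ⟨z, β, hz⟩ := z
    obtain ⟨γ, h1, h2⟩ := exists_ge_ge α β
    exact ⟨OrderDual.toDual ⟨y ⊓ z, γ, fun δ hδ =>
      le_inf (hy δ (h1.trans hδ)) (hz δ (h2.trans hδ))⟩, inf_le_left, inf_le_right⟩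
  have hne : Nonempty (↥S)ᵒᵈ := ⟨⟨u, Classical.arbitrary A, fun α _ => hu α⟩⟩
  refine ⟨(↥S)ᵒᵈ, inferInstance, hdir, hne, fun y => (OrderDual.ofDual y : S).1,
    ⟨fun y z hyz => hyz, ?_, ?_⟩, ?_⟩
  · rintro _ ⟨y, rfl⟩
    exact hS _ (OrderDual.ofDual y).2
  · intro w hw
    have hw' : w⁺ = 0 := h _ (posPart_nonneg w) fun y α₀ hy =>
      sup_le (hw ⟨OrderDual.toDual ⟨y, α₀, hy⟩, rfl⟩) (hS y ⟨α₀, hy⟩)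
    exact posPart_eq_zero.1 hw'
  · intro y
    simp only [sub_zero]
    exact (OrderDual.ofDual y).2

lemma OrderConvergesTo.uoConvergesTo_zero {A : Type v} [Preorder A] {x : A → X}
    (h : OrderConvergesTo x 0) : UOConvergesTo x 0 := by
  intro u hu
  obtain ⟨B, i1, i2, i3, y, hy, hxy⟩ := h
  refine ⟨B, i1, i2, i3, y, hy, fun β => ?_⟩
  obtain ⟨α₀, hα₀⟩ := hxy β
  refine ⟨α₀, fun α hα => ?_⟩
  rw [sub_zero (|x α - 0| ⊓ u), abs_of_nonneg (le_inf (abs_nonneg _) hu)]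
  exact inf_le_left.trans (hα₀ α hα)

end VectorLattice

/-! ### Norm, order and unbounded convergence -/

section BanachLattice

variable {X : Type u} [NormedAddCommGroup X] [Lattice X] [IsOrderedAddMonoid X] [HasSolidNorm X]

lemma norm_le_norm_of_nonneg_of_le {a b : X} (ha : 0 ≤ a) (hab : a ≤ b) : ‖a‖ ≤ ‖b‖ :=
  norm_le_norm_of_abs_le_abs (by rwa [abs_of_nonneg ha, abs_of_nonneg (ha.trans hab)])

lemma UOConvergesTo.unConvergesTo_zero (hX : IsOrderContinuousLattice X) {A : Type v}
    [Preorder A] [IsDirectedOrder A] [Nonempty A] {x : A → X} (h : UOConvergesTo x 0) :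
    UNConvergesTo x 0 := by
  intro u hu
  obtain ⟨B, i1, i2, i3, y, hy, hxy⟩ := h u hu
  obtain ⟨-, hglb⟩ := hX B y hy
  have hnn : ∀ α, 0 ≤ |x α - 0| ⊓ u := fun α => le_inf (abs_nonneg _) hu
  refine Metric.tendsto_nhds.2 fun ε hε => ?_
  obtain ⟨β, hβ⟩ : ∃ β, ‖y β‖ < ε := by
    by_contra! hcon
    exact hε.not_ge (hglb.2 (Set.forall_mem_range.2 hcon))
  obtain ⟨α₀, hα₀⟩ := hxy β
  filter_upwards [eventually_ge_atTop α₀] with α hα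
  have h1 := hα₀ α hα
  rw [sub_zero (|x α - 0| ⊓ u), abs_of_nonneg (hnn α)] at h1
  rw [dist_zero_right, norm_norm]
  exact (norm_le_norm_of_nonneg_of_le (hnn α) h1).trans_lt hβ

lemma unConvergesTo_zero_of_tendsto_norm {A : Type v} [Preorder A] {x : A → X}
    (h : Tendsto (fun α => ‖x α‖) atTop (𝓝 0)) : UNConvergesTo x 0 := fun u hu => by
  refine squeeze_zero (fun _ => norm_nonneg _) (fun α => ?_) h
  rw [sub_zero, ← norm_abs_eq_norm (x α)]
  exact norm_le_norm_of_nonneg_of_le (le_inf (abs_nonneg _) hu) inf_le_left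

variable [NormedSpace ℝ X] [IsOrderedModule ℝ X]

lemma nonpos_of_forall_nsmul_le {w u : X} (h : ∀ n : ℕ, n • w ≤ u) : w ≤ 0 := by
  have hlim : Tendsto (fun n : ℕ => (1 / ((n : ℝ) + 1)) • u) atTop (𝓝 0) := by
    simpa using (tendsto_one_div_add_atTop_nhds_zero_nat (𝕜 := ℝ)).smul_const u
  refine ge_of_tendsto' hlim fun n => ?_
  have hn : (0 : ℝ) < (n : ℝ) + 1 := by positivity
  have h1 := smul_le_smul_of_nonneg_left (h (n + 1)) (one_div_pos.2 hn).le
  rwa [← Nat.cast_smul_eq_nsmul ℝ, smul_smul, Nat.cast_succ, one_div_mul_cancel hn.ne',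
    one_smul] at h1

/-- The differences of consecutive terms of an order bounded decreasing sequence are order null,
although the sequence need not have an infimum: they are dominated by `y n - b` for every lower
bound `b`, and these elements have infimum `0` because `X` is Archimedean. -/
lemma orderConvergesTo_sub_succ {y : ℕ → X} (hy : Antitone y) (hb : BddBelow (Set.range y)) :
    OrderConvergesTo (fun n => y n - y (n + 1)) 0 := by
  obtain ⟨b, hb⟩ := hb
  have hd : ∀ n, |y n - y (n + 1)| = y n - y (n + 1) := fun n =>
    abs_of_nonneg (sub_nonneg.2 (hy n.le_succ))
  have hle : ∀ c ∈ lowerBounds (Set.range y), ∀ m n, m ≤ n → |y n - y (n + 1)| ≤ y m - c :=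
    fun c hc m n hmn => by rw [hd]; exact sub_le_sub (hy hmn) (hc ⟨_, rfl⟩)
  refine orderConvergesTo_zero_of_forall_le (fun n => hle b hb 0 n n.zero_le) fun w hw h => ?_
  have hstep : ∀ k : ℕ, b + k • w ∈ lowerBounds (Set.range y) := by
    intro k
    induction k with
    | zero => simpa using hb
    | succ k ih =>
      rintro _ ⟨n, rfl⟩
      rw [succ_nsmul, ← add_assoc, ← le_sub_iff_add_le']
      exact h _ n (hle _ ih n)
  exact le_antisymm (nonpos_of_forall_nsmul_le (u := y 0 - b) fun k =>
    le_sub_iff_add_le'.2 (hstep k ⟨0, rfl⟩)) hw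

end BanachLattice

/-! ### Order continuity and norm null sequences without atoms -/

section BanachLattice

/-- Consecutive terms of every order bounded decreasing sequence have differences tending to `0`
in norm. In a Banach lattice this is a sequential form of order continuity. -/
def DecrementsTendToZero (X : Type u) [NormedAddCommGroup X] [Lattice X] : Prop :=
  ∀ y : ℕ → X, Antitone y → BddBelow (Set.range y) →
    Tendsto (fun n => ‖y n - y (n + 1)‖) atTop (𝓝 0)

lemma DecrementsTendToZero.exists_tendsto {X : Type u} [NormedAddCommGroup X] [Lattice X]
    [CompleteSpace X] (hX : DecrementsTendToZero X) {A : Type v} [Preorder A] [IsDirectedOrder A]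
    [Nonempty A] {x : A → X} (hx : Antitone x) (hb : BddBelow (Set.range x)) :
    ∃ l, Tendsto x atTop (𝓝 l) := by
  have key : ∀ ε > 0, ∃ α, ∀ β, α ≤ β → ‖x α - x β‖ < ε := by
    by_contra! hcon
    obtain ⟨ε, hε, h⟩ := hcon
    choose f hf1 hf2 using h
    let s : ℕ → A := fun n => f^[n] (Classical.arbitrary A)
    have hs : ∀ n, s (n + 1) = f (s n) := fun n => Function.iterate_succ_apply' f n _
    have hmono : Monotone s := monotone_nat_of_le_succ fun n => by rw [hs]; exact hf1 _
    have hlim := hX (x ∘ s) (hx.comp_monotone hmono) (hb.mono (Set.range_comp_subset_range s x))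
    refine hε.not_ge (ge_of_tendsto' hlim fun n => ?_)
    simp only [Function.comp_apply, hs]
    exact hf2 _
  refine cauchy_map_iff_exists_tendsto.1 (Metric.cauchy_iff.2 ⟨inferInstance, fun ε hε => ?_⟩)
  obtain ⟨α, hα⟩ := key (ε / 2) (half_pos hε)
  refine ⟨x '' Set.Ici α, image_mem_map (Ici_mem_atTop α), ?_⟩
  rintro _ ⟨β, hβ, rfl⟩ _ ⟨γ, hγ, rfl⟩
  calc dist (x β) (x γ) ≤ dist (x α) (x β) + dist (x α) (x γ) := dist_triangle_left _ _ _
    _ < ε / 2 + ε / 2 := by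
      rw [dist_eq_norm, dist_eq_norm]
      exact add_lt_add (hα β hβ) (hα γ hγ)
    _ = ε := add_halves ε

variable {X : Type u} [NormedAddCommGroup X] [Lattice X] [IsOrderedAddMonoid X]

lemma DecrementsTendToZero.tendsto_norm_of_disjoint (hX : DecrementsTendToZero X) {p : ℕ → X}
    {u : X} (hu : 0 ≤ u) (hp : ∀ n, 0 ≤ p n) (hpu : ∀ n, p n ≤ u)
    (hd : ∀ i j, i < j → p i ⊓ p j = 0) : Tendsto (fun n => ‖p n‖) atTop (𝓝 0) := by
  have h := hX (fun n => -∑ i ∈ Finset.range n, p i)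
    (antitone_nat_of_succ_le fun n => by
      rw [Finset.sum_range_succ]
      exact neg_le_neg (le_add_of_nonneg_right (hp n)))
    ⟨-u, by
      rintro _ ⟨n, rfl⟩
      exact neg_le_neg (sum_range_le_of_disjoint hu hp hpu hd n)⟩
  simpa [Finset.sum_range_succ] using h

variable [HasSolidNorm X]

lemma DecrementsTendToZero.isOrderContinuousLattice [CompleteSpace X]
    (hX : DecrementsTendToZero X) : IsOrderContinuousLattice X := by
  intro A _ _ _ x ⟨hx, hglb⟩
  have hpos : ∀ α, 0 ≤ x α := fun α => hglb.1 ⟨α, rfl⟩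
  have hanti : Antitone fun α => ‖x α‖ := fun α β h =>
    norm_le_norm_of_nonneg_of_le (hpos β) (hx h)
  obtain ⟨l, hl⟩ := hX.exists_tendsto hx ⟨0, hglb.1⟩
  have hl0 : l = 0 := (isGLB_of_tendsto_atTop hx hl).unique hglb
  refine ⟨hanti, isGLB_of_tendsto_atTop hanti ?_⟩
  simpa [hl0] using hl.norm

variable [NormedSpace ℝ X] [IsOrderedModule ℝ X]

lemma exists_disjoint_of_not_isVectorLatticeAtom {v : X} (hv : 0 < v)
    (h : ¬ IsVectorLatticeAtom v) : ∃ p q, 0 < p ∧ 0 < q ∧ p ≤ v ∧ q ≤ v ∧ p ⊓ q = 0 := by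
  obtain ⟨x, hx0, hxv, hx⟩ : ∃ x, 0 ≤ x ∧ x ≤ v ∧ ∀ c : ℝ, 0 ≤ c → x ≠ c • v := by
    by_contra! hcon
    exact h ⟨hv, hcon⟩
  -- Otherwise `[0, 1]` is covered by two closed sets of scalars, those with `x ≤ t • v` and those
  -- with `t • v ≤ x`; being connected, it contains a scalar `t` with `x = t • v`.
  by_contra hcon
  have hdich : ∀ t ∈ Set.Icc (0 : ℝ) 1, x ≤ t • v ∨ t • v ≤ x := by
    intro t ht
    by_contra! hne
    refine hcon ⟨(x - t • v)⁺, (x - t • v)⁻, ?_, ?_, ?_, ?_, posPart_inf_negPart_eq_zero _⟩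
    · refine (posPart_nonneg _).lt_of_ne' fun h0 => hne.1 ?_
      exact sub_nonpos.1 (posPart_eq_zero.1 h0)
    · refine (negPart_nonneg _).lt_of_ne' fun h0 => hne.2 ?_
      exact sub_nonneg.1 (negPart_eq_zero.1 h0)
    · exact sup_le ((sub_le_self _ (smul_nonneg ht.1 hv.le)).trans hxv) hv.le
    · refine sup_le ?_ hv.le
      rw [neg_sub]
      refine (sub_le_self _ hx0).trans ?_
      simpa using smul_le_smul_of_nonneg_right ht.2 hv.le
  have hcont : Continuous fun t : ℝ => t • v := continuous_id.smul continuous_const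
  obtain ⟨t, ht, h1, h2⟩ := isPreconnected_closed_iff.1 (isPreconnected_Icc (a := (0 : ℝ)) (b := 1))
    {t | x ≤ t • v} {t | t • v ≤ x} (isClosed_le continuous_const hcont)
    (isClosed_le hcont continuous_const) hdich
    ⟨1, by simp, by simpa using hxv⟩ ⟨0, by simp, by simpa using hx0⟩
  exact hx t ht.1 (le_antisymm h1 h2)

lemma exists_disjoint_seq_of_no_atom {v : X} (hv : 0 < v)
    (h : ∀ a, IsVectorLatticeAtom a → ¬ a ≤ v) :
    ∃ p : ℕ → X, (∀ n, 0 < p n) ∧ (∀ n, p n ≤ v) ∧ ∀ i j, i < j → p i ⊓ p j = 0 := by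
  have hsplit : ∀ w : {w : X // 0 < w ∧ w ≤ v}, ∃ (p : X) (q : {w : X // 0 < w ∧ w ≤ v}),
      0 < p ∧ p ≤ w ∧ q.1 ≤ w ∧ p ⊓ q = 0 := by
    rintro ⟨w, hw0, hwv⟩
    obtain ⟨p, q, hp, hq, hpw, hqw, hpq⟩ :=
      exists_disjoint_of_not_isVectorLatticeAtom hw0 fun ha => h w ha hwv
    exact ⟨p, ⟨q, hq, hqw.trans hwv⟩, hp, hpw, hqw, hpq⟩
  choose p q hp hpw hqw hpq using hsplit
  let w : ℕ → {w : X // 0 < w ∧ w ≤ v} := fun n => q^[n] ⟨v, hv, le_rfl⟩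
  have hw : ∀ n, w (n + 1) = q (w n) := fun n => Function.iterate_succ_apply' q n _
  have hanti : Antitone fun n => (w n).1 := antitone_nat_of_succ_le fun n => by
    rw [hw]
    exact hqw _
  refine ⟨fun n => p (w n), fun n => hp _, fun n => (hpw _).trans (w n).2.2, fun i j hij => ?_⟩
  refine inf_eq_zero_of_le (hp _).le (hp _).le le_rfl ?_ (hpq (w i))
  rw [← hw]
  exact (hpw _).trans (hanti (Nat.succ_le_of_lt hij))

/-- If no atom lies below `e`, then `e` is approximated in norm by finite suprema of elements of
`[0, e]` of arbitrarily small norm. -/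
lemma DecrementsTendToZero.exists_finset_sup'_near [CompleteSpace X] (hX : DecrementsTendToZero X)
    {e : X} (he : 0 ≤ e) (hatom : ∀ a, IsVectorLatticeAtom a → ¬ a ≤ e) {ε : ℝ} (hε : 0 < ε) :
    ∃ (F : Finset X) (hF : F.Nonempty), (∀ f ∈ F, 0 ≤ f ∧ f ≤ e ∧ ‖f‖ ≤ ε) ∧
      ‖e - F.sup' hF id‖ ≤ ε := by
  classical
  let S := {F : Finset X // F.Nonempty ∧ ∀ f ∈ F, 0 ≤ f ∧ f ≤ e ∧ ‖f‖ ≤ ε}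
  have hdir : IsDirectedOrder S := ⟨fun F G => ⟨⟨F.1 ∪ G.1, F.2.1.inl, fun f hf =>
    (Finset.mem_union.1 hf).elim (F.2.2 f) (G.2.2 f)⟩, Finset.subset_union_left,
    Finset.subset_union_right⟩⟩
  have hne : Nonempty S := ⟨⟨{0}, by simp, by simp [he, hε.le]⟩⟩
  let x : S → X := fun F => e - F.1.sup' F.2.1 id
  have hx : Antitone x := fun F G hFG => sub_le_sub_left (Finset.sup'_mono id hFG F.2.1) e
  have hx0 : ∀ F, 0 ≤ x F := fun F => sub_nonneg.2 (Finset.sup'_le _ _ fun f hf => (F.2.2 f hf).2.1)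
  obtain ⟨v, hv⟩ := hX.exists_tendsto hx ⟨0, Set.forall_mem_range.2 hx0⟩
  have hglb := isGLB_of_tendsto_atTop hx hv
  have hv0 : 0 ≤ v := hglb.2 (Set.forall_mem_range.2 hx0)
  have hsmall : ∀ f, 0 ≤ f → f ≤ e → ‖f‖ ≤ ε → f + v ≤ e := by
    intro f h0 h1 h2
    have h3 : v ≤ x ⟨{f}, by simp, by simp [h0, h1, h2]⟩ := hglb.1 ⟨_, rfl⟩
    simpa [x, le_sub_iff_add_le'] using h3
  have hve : v ≤ e := by simpa using hsmall 0 le_rfl he (by rw [norm_zero]; exact hε.le)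
  -- Every `f ≤ v` of small norm can be blown up to norm about `ε` within `[0, e]`.
  have hblow : ∀ f, 0 ≤ f → f ≤ v → ∀ n : ℕ, n * ‖f‖ ≤ ε → n • f ≤ e := by
    intro f hf0 hfv n
    induction n with
    | zero => exact fun _ => by simpa using he
    | succ n ih =>
      intro hn
      push_cast at hn
      have hn' : n * ‖f‖ ≤ ε := by linarith [norm_nonneg f]
      rw [succ_nsmul]
      refine (add_le_add_right hfv _).trans (hsmall _ (nsmul_nonneg hf0 n) (ih hn') ?_)
      exact norm_nsmul_le.trans hn'
  have hvz : v = 0 := by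
    by_contra hvne
    obtain ⟨p, hp0, hpv, hpd⟩ := exists_disjoint_seq_of_no_atom (hv0.lt_of_ne' hvne)
      fun a ha hav => hatom a ha (hav.trans hve)
    have hpn : ∀ n, 0 < ‖p n‖ := fun n => norm_pos_iff.2 (hp0 n).ne'
    have hlim := hX.tendsto_norm_of_disjoint hv0 (fun n => (hp0 n).le) hpv hpd
    let m : ℕ → ℕ := fun n => ⌊ε / ‖p n‖⌋₊
    have hm : ∀ n, m n * ‖p n‖ ≤ ε := fun n =>
      (le_div_iff₀ (hpn n)).1 (Nat.floor_le (div_nonneg hε.le (norm_nonneg _)))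
    have hlim2 := hX.tendsto_norm_of_disjoint he (p := fun n => m n • p n)
      (fun n => nsmul_nonneg (hp0 n).le _) (fun n => hblow _ (hp0 n).le (hpv n) _ (hm n))
      fun i j hij => by
        refine inf_nsmul_eq_zero (nsmul_nonneg (hp0 i).le _) (hp0 j).le ?_ _
        rw [inf_comm]
        refine inf_nsmul_eq_zero (hp0 j).le (hp0 i).le ?_ _
        rw [inf_comm]
        exact hpd i j hij
    have hge : ∀ n, ε ≤ ‖m n • p n‖ + ‖p n‖ := by
      intro n
      rw [← Nat.cast_smul_eq_nsmul ℝ, norm_smul, RCLike.norm_natCast, ← add_one_mul]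
      exact ((div_lt_iff₀ (hpn n)).1 (Nat.lt_floor_add_one _)).le
    have := ge_of_tendsto' (hlim2.add hlim) hge
    linarith
  rw [hvz] at hv
  obtain ⟨F, hF⟩ := ((Metric.tendsto_nhds.1 hv) ε hε).exists
  exact ⟨F.1, F.2.1, F.2.2, by simpa [x] using hF.le⟩

/-- The analogue of the typewriter sequence: if no atom lies below `e`, then `[0, e]` contains a
norm null sequence such that `e` is below every upper bound of every tail. -/
lemma DecrementsTendToZero.exists_typewriter_seq [CompleteSpace X] (hX : DecrementsTendToZero X)
    {e : X} (he : 0 ≤ e) (hatom : ∀ a, IsVectorLatticeAtom a → ¬ a ≤ e) :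
    ∃ x : ℕ → X, (∀ n, 0 ≤ x n ∧ x n ≤ e) ∧ Tendsto (fun n => ‖x n‖) atTop (𝓝 0) ∧
      ∀ y n₀, (∀ n, n₀ ≤ n → x n ≤ y) → e ≤ y := by
  have hlim : Tendsto (fun k : ℕ => 1 / ((k : ℝ) + 1)) atTop (𝓝 0) :=
    tendsto_one_div_add_atTop_nhds_zero_nat
  choose F hF hFle hFnear using fun k : ℕ =>
    hX.exists_finset_sup'_near he hatom (ε := 1 / ((k : ℝ) + 1)) (by positivity)
  let I := Σ k : ℕ, F k
  have hInf : Infinite I :=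
    Infinite.of_injective (fun k => (⟨k, (hF k).choose, (hF k).choose_spec⟩ : I))
      fun k l hkl => congrArg Sigma.fst hkl
  obtain ⟨σ⟩ : Nonempty (ℕ ≃ I) := nonempty_equiv_of_countable
  -- Every block is finite, so only finitely many indices belong to the first blocks.
  have hfst : Tendsto (fun i : I => i.1) cofinite atTop := by
    rw [← Nat.cofinite_eq_atTop]
    refine Tendsto.cofinite_of_finite_preimage_singleton fun k => ?_
    refine (Set.finite_range fun f : F k => (⟨k, f⟩ : I)).subset ?_
    rintro ⟨_, f⟩ rfl
    exact ⟨f, rfl⟩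
  have hσ : Tendsto (fun n => (σ n).1) atTop atTop := by
    rw [← Nat.cofinite_eq_atTop] at hfst ⊢
    exact hfst.comp σ.injective.tendsto_cofinite
  refine ⟨fun n => ((σ n).2 : X),
    fun n => ⟨(hFle _ _ (σ n).2.2).1, (hFle _ _ (σ n).2.2).2.1⟩, ?_, fun y n₀ hy => ?_⟩
  · exact squeeze_zero (fun n => norm_nonneg _)
      (fun n => (hFle (σ n).1 _ (σ n).2.2).2.2) (hlim.comp hσ)
  · -- The indices before `n₀` meet only finitely many blocks.
    obtain ⟨K, hK⟩ : ∃ K, ∀ n < n₀, (σ n).1 < K := by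
      obtain ⟨K, hK⟩ := ((Finset.range n₀).image fun n => (σ n).1).exists_nat_subset_range
      exact ⟨K, fun n hn => Finset.mem_range.1 <|
        hK (Finset.mem_image_of_mem _ (Finset.mem_range.2 hn))⟩
    have hsup : ∀ k, K ≤ k → (F k).sup' (hF k) id ≤ y := by
      refine fun k hk => Finset.sup'_le _ _ fun f hf => ?_
      have hn : n₀ ≤ σ.symm ⟨k, f, hf⟩ := by
        by_contra! hlt
        have := hK _ hlt
        simp only [Equiv.apply_symm_apply] at this
        omega
      have hle : ((σ (σ.symm ⟨k, f, hf⟩)).2 : X) ≤ y := hy _ hn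
      rwa [Equiv.apply_symm_apply] at hle
    have hconv : Tendsto (fun k => (F k).sup' (hF k) id) atTop (𝓝 e) := by
      rw [tendsto_iff_norm_sub_tendsto_zero]
      refine squeeze_zero (fun k => norm_nonneg _) (fun k => ?_) hlim
      rw [norm_sub_rev]
      exact hFnear k
    exact le_of_tendsto hconv ((eventually_ge_atTop K).mono hsup)

end BanachLattice

/-! ### Atomic Banach lattices -/

section BanachLattice

variable {X : Type u} [NormedAddCommGroup X] [NormedSpace ℝ X] [Lattice X] [IsOrderedAddMonoid X]
  [IsOrderedModule ℝ X]

/-- If the coordinate of `v` at the atom `a` is at most `ε < 1`, then replacing the coordinate of an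
upper bound `c • a + u'` by `ε` gives an upper bound again. -/
lemma le_smul_add_of_inf_le {a u' v : X} {c ε : ℝ} (ha : 0 ≤ a) (hu' : 0 ≤ u')
    (hc : 0 ≤ c) (hε : ε < 1) (hε0 : 0 ≤ ε) (hv : 0 ≤ v)
    (hvu : v ≤ c • a + u') (hva : v ⊓ a ≤ ε • a) : v ≤ ε • a + u' := by
  set r := (v - ε • a)⁺ with hr
  have hr0 : 0 ≤ r := posPart_nonneg _
  have hrv : r ≤ v := sup_le (sub_le_self _ (smul_nonneg hε0 ha)) hv
  have hra : r ⊓ a = 0 := by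
    have h1 : r ⊓ (1 - ε) • a = 0 := by
      have h2 : (v - ε • a) ⊓ (1 - ε) • a ≤ 0 := by
        rw [sub_smul, one_smul, ← inf_sub]
        exact sub_nonpos.2 hva
      have h3 : 0 ≤ (1 - ε) • a := smul_nonneg (sub_nonneg.2 hε.le) ha
      refine le_antisymm ?_ (le_inf hr0 h3)
      have h4 : r ⊓ (1 - ε) • a - (v - ε • a)⁻ ≤ 0 := by
        refine (le_inf ?_ ((sub_le_self _ (negPart_nonneg _)).trans inf_le_right)).trans h2
        rw [sub_le_iff_le_add]
        refine inf_le_left.trans (sub_le_iff_le_add.1 ?_)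
        rw [hr, posPart_sub_negPart]
      calc r ⊓ (1 - ε) • a ≤ r ⊓ (v - ε • a)⁻ := le_inf inf_le_left (sub_nonpos.1 h4)
        _ = 0 := posPart_inf_negPart_eq_zero _
    have hε1 : 0 < 1 - ε := sub_pos.2 hε
    have h5 := inf_smul_eq_zero hr0 (smul_nonneg hε1.le ha) h1 (inv_nonneg.2 hε1.le)
    rwa [inv_smul_smul₀ hε1.ne'] at h5
  have hru : r ≤ u' := by
    have h1 : r ⊓ (c • a + u') ≤ r ⊓ c • a + r ⊓ u' :=
      inf_add_le_inf_add_inf hr0 (smul_nonneg hc ha) hu'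
    rw [inf_eq_left.2 (hrv.trans hvu), inf_smul_eq_zero hr0 ha hra hc, zero_add] at h1
    exact h1.trans inf_le_right
  exact sub_le_iff_le_add'.1 ((le_posPart _).trans hru)

/-- The elements disjoint from a given positive element form a band. -/
lemma exists_isBand_disjoint {w : X} (hw : 0 ≤ w) :
    ∃ M : Submodule ℝ X, IsBand M ∧ ∀ x, x ∈ M ↔ |x| ⊓ w = 0 := by
  have hsolid : ∀ {x z : X}, |x| ⊓ w = 0 → 0 ≤ z → z ≤ |x| → z ⊓ w = 0 := fun hx hz hzx =>
    inf_eq_zero_of_le hz hw hzx le_rfl hx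
  refine ⟨{ carrier := {x | |x| ⊓ w = 0}, add_mem' := ?_, zero_mem' := ?_, smul_mem' := ?_ },
    ⟨?_, ?_⟩, fun x => Iff.rfl⟩
  · intro x y hx hy
    refine inf_eq_zero_of_le (abs_nonneg _) hw (abs_add_le x y) le_rfl ?_
    rw [Set.mem_ofPred_eq, inf_comm] at hx hy
    rw [inf_comm]
    exact inf_add_eq_zero hw (abs_nonneg x) (abs_nonneg y) hx hy
  · simpa using hw
  · intro c x hx
    refine inf_eq_zero_of_le (abs_nonneg _) hw (abs_smul_le c x) le_rfl ?_
    rw [Set.mem_ofPred_eq, inf_comm] at hx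
    rw [inf_comm]
    exact inf_smul_eq_zero hw (abs_nonneg x) hx (abs_nonneg c)
  · intro x hx y hyx
    exact hsolid hx (abs_nonneg y) hyx
  · intro D s hD hs
    change |s| ⊓ w = 0
    rcases D.eq_empty_or_nonempty with rfl | ⟨d₀, hd₀⟩
    · -- The supremum of the empty set is a least element, which exists only if `X` is trivial.
      have hbot : ∀ z, s ≤ z := fun z => hs.2 (by simp)
      have hs0 : 0 ≤ s := by simpa using hbot (s + s)
      have hw0 : w = 0 := le_antisymm (neg_nonneg.1 (hs0.trans (hbot (-w)))) hw
      simp [hw0]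
    have hneg : ∀ d ∈ D, s⁻ ≤ d⁻ := fun d hd => negPart_anti (hs.1 hd)
    have h1 : s⁻ ⊓ w = 0 := hsolid (hD hd₀) (negPart_nonneg s)
      ((hneg d₀ hd₀).trans (by
        rw [← posPart_add_negPart]
        exact le_add_of_nonneg_left (posPart_nonneg _)))
    have h2 : s⁺ ⊓ w = 0 := by
      set t := s⁺ ⊓ w with ht
      have ht0 : 0 ≤ t := le_inf (posPart_nonneg s) hw
      have hub : s ≤ s - t := by
        refine hs.2 fun d hd => ?_
        have hdt : d⁺ ⊓ t = 0 := by
          refine inf_eq_zero_of_le (posPart_nonneg d) ht0 le_rfl inf_le_right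
            (hsolid (hD hd) (posPart_nonneg d) ?_)
          rw [← posPart_add_negPart]
          exact le_add_of_nonneg_right (negPart_nonneg _)
        have h3 : d⁺ + t ≤ s⁺ := add_le_of_inf_eq_zero hdt (posPart_mono (hs.1 hd)) inf_le_left
        rw [le_sub_iff_add_le]
        calc d + t = d⁺ + t - d⁻ := by
              conv_lhs => rw [← posPart_sub_negPart d]
              abel
          _ ≤ s⁺ - s⁻ := sub_le_sub h3 (hneg d hd)
          _ = s := posPart_sub_negPart s
      exact le_antisymm (by simpa using hub) ht0
    rw [inf_comm] at h1 h2
    rw [← posPart_add_negPart, inf_comm]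
    exact inf_add_eq_zero hw (posPart_nonneg s) (negPart_nonneg s) h2 h1

lemma IsAtomicVectorLattice.exists_atom_inf_ne_zero (hX : IsAtomicVectorLattice X) {w : X}
    (hw : 0 < w) : ∃ a, IsVectorLatticeAtom a ∧ a ⊓ w ≠ 0 := by
  by_contra! hcon
  obtain ⟨M, hM, hmem⟩ := exists_isBand_disjoint hw.le
  have hle : bandGenerated {a : X | IsVectorLatticeAtom a} ≤ M := sInf_le ⟨hM, fun a ha => by
    rw [SetLike.mem_coe, hmem, abs_of_nonneg ha.1.le]
    exact hcon a ha⟩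
  have hwM : w ∈ M := hle (by rw [show bandGenerated _ = _ from hX]; trivial)
  rw [hmem, abs_of_nonneg hw.le, inf_idem] at hwM
  exact hw.ne' hwM

variable [HasSolidNorm X]

lemma isAtomicVectorLattice_of_forall_exists_atom_le
    (h : ∀ e : X, 0 < e → ∃ a, IsVectorLatticeAtom a ∧ a ≤ e) : IsAtomicVectorLattice X := by
  refine (Submodule.eq_top_iff').2 fun x => Submodule.mem_sInf.2 fun M ⟨hM, hatoms⟩ => ?_
  -- A positive `x` is the supremum of the elements of `M` in `[0, x]`: a positive gap would contain
  -- an atom, which could be added to these elements again and again.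
  have hpos : ∀ x : X, 0 ≤ x → x ∈ M := by
    intro x hx
    refine hM.2 {z | z ∈ M ∧ z ≤ x} x (fun z hz => hz.1) ⟨fun z hz => hz.2, fun y hy => ?_⟩
    by_contra hxy
    have hgap : 0 < x - x ⊓ y := (sub_nonneg.2 inf_le_left).lt_of_ne' fun h0 =>
      hxy (inf_eq_left.1 (sub_eq_zero.1 h0).symm)
    obtain ⟨a, ha, hle⟩ := h _ hgap
    have haM : a ∈ M := hatoms ha
    have hn : ∀ n : ℕ, n • a ≤ x := by
      intro n
      induction n with
      | zero => simpa using hx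
      | succ n ih =>
        have h1 : n • a ≤ x ⊓ y := le_inf ih (hy ⟨M.smul_of_tower_mem n haM, ih⟩)
        rw [succ_nsmul]
        simpa using add_le_add h1 hle
    exact ha.1.not_ge (nonpos_of_forall_nsmul_le hn)
  rw [← posPart_sub_negPart x]
  exact M.sub_mem (hpos _ (posPart_nonneg x)) (hpos _ (negPart_nonneg x))

/-- The band projection onto the line of an atom, at a positive element. -/
lemma IsVectorLatticeAtom.exists_decomposition {a : X} (ha : IsVectorLatticeAtom a) {u : X}
    (hu : 0 ≤ u) : ∃ (c : ℝ) (u' : X), 0 ≤ c ∧ 0 ≤ u' ∧ u = c • a + u' ∧ u' ⊓ a = 0 := by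
  let T : Set ℝ := {t | t • a ≤ u}
  have hT0 : (0 : ℝ) ∈ T := by simpa [T] using hu
  have hTclosed : IsClosed T :=
    isClosed_le (continuous_id.smul continuous_const) continuous_const
  have hTbdd : BddAbove T := by
    by_contra hT
    refine ha.1.not_ge (nonpos_of_forall_nsmul_le (u := u) fun n => ?_)
    obtain ⟨t, ht, hnt⟩ := not_bddAbove_iff.1 hT n
    rw [← Nat.cast_smul_eq_nsmul ℝ]
    exact (smul_le_smul_of_nonneg_right hnt.le ha.1.le).trans ht
  have hc : sSup T • a ≤ u := hTclosed.csSup_mem ⟨0, hT0⟩ hTbdd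
  have hu' : 0 ≤ u - sSup T • a := sub_nonneg.2 hc
  refine ⟨sSup T, u - sSup T • a, le_csSup hTbdd hT0, hu', by abel, ?_⟩
  obtain ⟨m, hm, hma⟩ := ha.2 _ (le_inf hu' ha.1.le) inf_le_right
  have hmem : sSup T + m ∈ T := by
    change (sSup T + m) • a ≤ u
    rw [add_smul, ← hma, ← le_sub_iff_add_le']
    exact inf_le_left
  have hm0 : m = 0 := le_antisymm (by simpa using le_csSup hTbdd hmem) hm
  rw [hma, hm0, zero_smul]

lemma IsAtomicVectorLattice.uoConvergesTo_zero (hX : IsAtomicVectorLattice X) {A : Type v}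
    [Preorder A] [IsDirectedOrder A] [Nonempty A] {x : A → X} (h : UNConvergesTo x 0) :
    UOConvergesTo x 0 := by
  intro u hu
  have hnn : ∀ α, 0 ≤ |x α - 0| ⊓ u := fun α => le_inf (abs_nonneg _) hu
  refine orderConvergesTo_zero_of_forall_le (u := u)
    (fun α => by rw [abs_of_nonneg (hnn α)]; exact inf_le_right) fun w hw hlow => ?_
  by_contra hw0
  obtain ⟨a, ha, haw⟩ := hX.exists_atom_inf_ne_zero (hw.lt_of_ne' hw0)
  obtain ⟨m, hm, hma⟩ := ha.2 _ (le_inf ha.1.le hw) inf_le_left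
  have hm0 : 0 < m := hm.lt_of_ne' fun h0 => haw (by rw [hma, h0, zero_smul])
  obtain ⟨c, u', hc, hu', rfl, hdis⟩ := ha.exists_decomposition hu
  -- The coordinates at `a` are eventually at most `ε`, so that `ε • a + u'` is an eventual upper
  -- bound; but a lower bound of all of these has coordinate at least `m > ε`.
  obtain ⟨ε, hε0, hε⟩ := exists_between (lt_min hm0 one_pos)
  have hev : ∀ᶠ α in atTop, |x α - 0| ⊓ a ≤ ε • a := by
    have hpos : 0 < ε * ‖a‖ := mul_pos hε0 (norm_pos_iff.2 ha.1.ne')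
    filter_upwards [(h a ha.1.le).eventually (gt_mem_nhds hpos)] with α hα
    obtain ⟨t, ht, hta⟩ := ha.2 _ (le_inf (abs_nonneg (x α - 0)) ha.1.le) inf_le_right
    rw [hta] at hα ⊢
    rw [norm_smul, Real.norm_of_nonneg ht] at hα
    exact smul_le_smul_of_nonneg_right (lt_of_mul_lt_mul_right hα (norm_nonneg a)).le ha.1.le
  obtain ⟨α₀, hα₀⟩ := eventually_atTop.1 hev
  have hwle : w ≤ ε • a + u' := by
    refine hlow _ α₀ fun α hα => ?_
    rw [abs_of_nonneg (hnn α)]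
    refine le_smul_add_of_inf_le ha.1.le hu' hc (hε.trans_le (min_le_right _ _)) hε0.le
      (hnn α) inf_le_right ?_
    exact (inf_le_inf_right a inf_le_left).trans (hα₀ α hα)
  have hma' : (m - ε) • a ≤ u' := by
    rw [sub_smul, sub_le_iff_le_add']
    exact (hma ▸ inf_le_right : m • a ≤ w).trans hwle
  have hmε : 0 < m - ε := sub_pos.2 (hε.trans_le (min_le_left _ _))
  have h1 : (m - ε) • a ⊓ a = 0 :=
    inf_eq_zero_of_le (smul_nonneg hmε.le ha.1.le) ha.1.le hma' le_rfl hdis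
  rw [inf_comm] at h1
  have h2 := inf_smul_eq_zero ha.1.le (smul_nonneg hmε.le ha.1.le) h1 (inv_nonneg.2 hmε.le)
  rw [inv_smul_smul₀ hmε.ne', inf_idem] at h2
  exact ha.1.ne' h2

lemma decrementsTendToZero_of_uo_imp_un
    (h : ∀ x : ℕ → X, UOConvergesTo x 0 → UNConvergesTo x 0) : DecrementsTendToZero X := by
  intro y hy hb
  obtain ⟨b, hlb⟩ := hb
  have hun := h _ (orderConvergesTo_sub_succ hy ⟨b, hlb⟩).uoConvergesTo_zero (y 0 - b)
    (sub_nonneg.2 (hlb ⟨0, rfl⟩))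
  refine hun.congr fun n => ?_
  rw [sub_zero, abs_of_nonneg (sub_nonneg.2 (hy n.le_succ)),
    inf_eq_left.2 (sub_le_sub (hy n.zero_le) (hlb ⟨n + 1, rfl⟩))]

lemma DecrementsTendToZero.isAtomicVectorLattice_of_un_imp_uo [CompleteSpace X]
    (hX : DecrementsTendToZero X) (h : ∀ x : ℕ → X, UNConvergesTo x 0 → UOConvergesTo x 0) :
    IsAtomicVectorLattice X := by
  refine isAtomicVectorLattice_of_forall_exists_atom_le fun e he => ?_
  by_contra! hatom
  obtain ⟨x, hxe, hx, htail⟩ := hX.exists_typewriter_seq he.le hatom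
  obtain ⟨B, _, _, _, y, ⟨-, hglb⟩, hxy⟩ := h x (unConvergesTo_zero_of_tendsto_norm hx) e he.le
  refine he.not_ge (hglb.2 ?_)
  rintro _ ⟨β, rfl⟩
  obtain ⟨n₀, hn₀⟩ := hxy β
  refine htail _ n₀ fun n hn => ?_
  have hle : |(|x n - 0| ⊓ e) - 0| ≤ y β := hn₀ n hn
  rwa [sub_zero, sub_zero, abs_of_nonneg (hxe n).1, inf_eq_left.2 (hxe n).2,
    abs_of_nonneg (hxe n).1] at hle

end BanachLattice

/-! ### The equivalence -/

theorem theorem2p7 {X : Type u} [NormedAddCommGroup X] [NormedSpace ℝ X] [CompleteSpace X]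
    [Lattice X] [IsOrderedAddMonoid X] [IsOrderedModule ℝ X] [HasSolidNorm X] :
    List.TFAE [
      ∀ (A : Type v) [Preorder A] [IsDirectedOrder A] [Nonempty A] (x : A → X),
        UOConvergesTo x 0 ↔ UNConvergesTo x 0,
      ∀ x : ℕ → X, UOConvergesTo x 0 ↔ UNConvergesTo x 0,
      IsOrderContinuousLattice X ∧ IsAtomicVectorLattice X] := by
  tfae_have 1 → 2 := by
    intro h x
    have h1 := h (ULift.{v} ℕ) (fun n => x n.down)
    let e : ULift.{v} ℕ ≃o ℕ := ULift.orderIso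
    have huo : UOConvergesTo (fun n : ULift.{v} ℕ => x n.down) 0 ↔ UOConvergesTo x 0 := by
      simp only [UOConvergesTo, OrderConvergesTo, ULift.exists, ULift.forall, ULift.up_le]
    have hun : UNConvergesTo (fun n : ULift.{v} ℕ => x n.down) 0 ↔ UNConvergesTo x 0 :=
      forall₂_congr fun u _ =>
        ⟨fun h => h.comp e.symm.tendsto_atTop, fun h => h.comp e.tendsto_atTop⟩
    rw [← huo, h1, hun]
  tfae_have 2 → 3 := fun h =>
    have hX := decrementsTendToZero_of_uo_imp_un fun x => (h x).1
    ⟨hX.isOrderContinuousLattice, hX.isAtomicVectorLattice_of_un_imp_uo fun x => (h x).2⟩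
  tfae_have 3 → 1 := fun ⟨hoc, hat⟩ _ _ _ _ _ =>
    ⟨fun h => h.unConvergesTo_zero hoc, fun h => hat.uoConvergesTo_zero h⟩
  tfae_finish
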